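/- Let $n\ge 0$ be an integer and let $\mathcal P(\mathbf R^n)$ be the set of Borel probability measures on $\mathbf R^n$. For real $\alpha\ge\beta\ge 2$ put $W_{\alpha,\beta}(x)=|x|^\alpha/\alpha-|x|^\beta/\beta$, and for $\alpha=\infty$ put $W_{\infty,\beta}(x)=-|x|^\beta/\beta$ if $|x|\le 1$ and $W_{\infty,\beta}(x)=+\infty$ if $|x|>1$. Let $$\mathcal E_{W_{\alpha,\beta}}(\mu)=\iint_{\mathbf R^n\times\mathbf R^n}W_{\alpha,\beta}(x-y)\,d\mu(x)\,d\mu(y)\in(-\infty,+\infty],\qquad \mu\in\mathcal P(\mathbf R^n).$$ The vertices of a unit $n$-simplex are $n+1$ points $x_0,\dots,x_n\in\mathbf R^n$ with $|x_i-x_j|=1$ for all $i<j$. **Corollary (Phase transition threshold).** For each $\beta\ge 2$ there is a minimal value $\alpha_\Delta(\beta)\in[\beta,\infty)$ (depending also on $n$) such that the following holds: for each $\alpha\in(\alpha_\Delta(\beta),\infty]$, a measure $\mu\in\mathcal P(\mathbf R^n)$ minimizes $\mathcal E_{W_{\alpha,\beta}}$ over $\mathcal P(\mathbf R^n)$ if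 and only if $\mu$ assigns mass $1/(n+1)$ to each vertex of some unit $n$-simplex. -/

import Mathlib

open MeasureTheory
open scoped ENNReal

namespace PowerLaw

/-- The attractive-repulsive power-law pair potential on `ℝⁿ`, with exponent of attraction
`α ∈ (-∞, ∞]` and exponent of repulsion `β`. For finite `α` it is `|x|^α / α - |x|^β / β`;
for `α = ∞` it is the hard confinement potential, equal to `-|x|^β / β` if `|x| ≤ 1` and to
`+∞` if `|x| > 1`. -/
noncomputable def potential {n : ℕ} (α : WithTop ℝ) (β : ℝ) (x : EuclideanSpace ℝ (Fin n)) :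
    EReal :=
  match α with
  | (a : ℝ) => ((‖x‖ ^ a / a - ‖x‖ ^ β / β : ℝ) : EReal)
  | ⊤ => if ‖x‖ ≤ 1 then ((-(‖x‖ ^ β / β) : ℝ) : EReal) else ⊤

/-- The interaction energy `∬ W(x - y) dμ(x) dμ(y)` of a probability measure for an
extended-real-valued pair potential `W`, as the integral of the positive part minus the integral
of the negative part. For a potential that is bounded below, such as `potential α β` with
`0 < β ≤ α`, the negative part has a finite integral, so the energy is a well-defined element
of `(-∞, ∞]`; no moment condition on `μ` is needed. -/
noncomputable def energy {n : ℕ} (W : EuclideanSpace ℝ (Fin n) → EReal)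
    (μ : ProbabilityMeasure (EuclideanSpace ℝ (Fin n))) : EReal :=
  ((∫⁻ p, (W (p.1 - p.2)).toENNReal
      ∂((μ : Measure (EuclideanSpace ℝ (Fin n))).prod
        (μ : Measure (EuclideanSpace ℝ (Fin n)))) : ℝ≥0∞) : EReal)
  - ((∫⁻ p, (-W (p.1 - p.2)).toENNReal
      ∂((μ : Measure (EuclideanSpace ℝ (Fin n))).prod
        (μ : Measure (EuclideanSpace ℝ (Fin n)))) : ℝ≥0∞) : EReal)

/-- `μ` minimizes the energy with exponents `α`, `β` among all Borel probability measures
on `ℝⁿ`. -/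
def IsEnergyMinimizer {n : ℕ} (α : WithTop ℝ) (β : ℝ)
    (μ : ProbabilityMeasure (EuclideanSpace ℝ (Fin n))) : Prop :=
  ∀ ν : ProbabilityMeasure (EuclideanSpace ℝ (Fin n)),
    energy (potential α β) μ ≤ energy (potential α β) ν

/-- The points `x 0, …, x k` are the vertices of a unit `k`-simplex in `ℝⁿ`: any two of them
are at distance one. -/
def IsUnitSimplexVertices {n k : ℕ} (x : Fin (k + 1) → EuclideanSpace ℝ (Fin n)) : Prop :=
  ∀ i j, i < j → dist (x i) (x j) = 1

/-- The probability measure `μ` on `ℝⁿ` assigns mass `1 / (n + 1)` to each vertex of some unit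
`n`-simplex. -/
def EquidistributesOverUnitSimplex {n : ℕ}
    (μ : ProbabilityMeasure (EuclideanSpace ℝ (Fin n))) : Prop :=
  ∃ x : Fin (n + 1) → EuclideanSpace ℝ (Fin n), IsUnitSimplexVertices x ∧
    ∀ i, (μ : Measure (EuclideanSpace ℝ (Fin n))) {x i} = ((n : ℝ≥0∞) + 1)⁻¹

end PowerLaw

namespace PowerLaw

/-! The quartic `r ^ 4 - 2 * r ^ 2` serves as a universal comparison potential. When `α > max 4 β`,
convexity of `t ↦ r ^ t` shows that the potential dominates `c` times the quartic for some `c > 0`,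
touching it only at separations 0 and 1 (`exists_dominatesQuartic_potential`).

The quartic energy of a centred measure is a polynomial in its second and fourth moments, and
tangent-line bounds at the moments of the unit simplex give the minimum `-n / (n + 1)`
(`quarticEnergy_ge`). Hence the energy is at least `-c * n / (n + 1)`, a value attained by
equidistributed simplices.

Equality forces almost all separations into `{0, 1}`. The support is then a set of at most `n + 1`
points at mutual distance one, and the mass of the diagonal, a sum of squared weights, is so small
that there must be exactly `n + 1` equal weights.

Thus `max 4 β` is an admissible threshold, and a least one exists because admissibility concerns
only `α` strictly above it. -/

/-! ### Comparison of the potentials with the quartic -/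

theorem rpow_le_secant {r s t u : ℝ} (hr : 0 < r) (hst : s ≤ t) (htu : t ≤ u) (hsu : s < u) :
    (u - s) * r ^ t ≤ (u - t) * r ^ s + (t - s) * r ^ u := by
  have hd : 0 < u - s := sub_pos.2 hsu
  have h := convexOn_exp.2 (Set.mem_univ (Real.log r * s)) (Set.mem_univ (Real.log r * u))
    (div_nonneg (sub_nonneg.2 htu) hd.le) (div_nonneg (sub_nonneg.2 hst) hd.le)
    (by field_simp; ring)
  have e : (u - t) / (u - s) * (Real.log r * s) + (t - s) / (u - s) * (Real.log r * u)
      = Real.log r * t := by field_simp; ring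
  simp only [smul_eq_mul, e, ← Real.rpow_def_of_pos hr] at h
  calc (u - s) * r ^ t
      ≤ (u - s) * ((u - t) / (u - s) * r ^ s + (t - s) / (u - s) * r ^ u) := by gcongr
    _ = _ := by field_simp

theorem rpow_lt_secant {r s t u : ℝ} (hr : 0 < r) (hr1 : r ≠ 1) (hst : s < t) (htu : t < u) :
    (u - s) * r ^ t < (u - t) * r ^ s + (t - s) * r ^ u := by
  have hsu := hst.trans htu
  have hd : 0 < u - s := sub_pos.2 hsu
  have hl : Real.log r ≠ 0 := Real.log_ne_zero_of_pos_of_ne_one hr hr1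
  have h := strictConvexOn_exp.2 (Set.mem_univ (Real.log r * s)) (Set.mem_univ (Real.log r * u))
    (fun e => hsu.ne (mul_left_cancel₀ hl e))
    (div_pos (sub_pos.2 htu) hd) (div_pos (sub_pos.2 hst) hd)
    (by field_simp; ring)
  have e : (u - t) / (u - s) * (Real.log r * s) + (t - s) / (u - s) * (Real.log r * u)
      = Real.log r * t := by field_simp; ring
  simp only [smul_eq_mul, e, ← Real.rpow_def_of_pos hr] at h
  calc (u - s) * r ^ t
      < (u - s) * ((u - t) / (u - s) * r ^ s + (t - s) / (u - s) * r ^ u) := by gcongr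
    _ = _ := by field_simp

/-- Among the power laws with `β ≥ 2` and `α > 4`, normalized to have the same minimum value,
the quartic one is the smallest, strictly so away from the separations `0` and `1`. -/
theorem quartic_lt_powerLaw {α β r : ℝ} (hβ : 2 ≤ β) (hα : 4 < α) (hβα : β < α)
    (hr : 0 < r) (hr1 : r ≠ 1) :
    (α - β) / (α * β) * (r ^ 4 - 2 * r ^ 2) < r ^ α / α - r ^ β / β := by
  -- Exponent `β` is interpolated between 2 and `α`, where `β = 2` is allowed, and 4 strictly
  -- between the same two. Weighted by `α` and `α - β`, the two bounds add up to `α - 2` times the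
  -- claim.
  have h1 := rpow_le_secant hr hβ hβα.le (by linarith)
  have h2 := rpow_lt_secant hr hr1 (show (2 : ℝ) < 4 by norm_num) hα
  have e4 : r ^ (4 : ℝ) = r ^ 4 := by exact_mod_cast Real.rpow_natCast r 4
  have e2 : r ^ (2 : ℝ) = r ^ 2 := by exact_mod_cast Real.rpow_natCast r 2
  rw [e2] at h1 h2
  rw [e4] at h2
  have hα0 : 0 < α := by linarith
  have hβ0 : 0 < β := by linarith
  rw [div_mul_eq_mul_div, div_sub_div _ _ hα0.ne' hβ0.ne', div_lt_div_iff_of_pos_right (by positivity)]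
  have h3 : α * ((α - 2) * r ^ β) ≤ α * ((α - β) * r ^ 2 + (β - 2) * r ^ α) := by gcongr
  have h4 : (α - β) * ((α - 2) * r ^ 4) < (α - β) * ((α - 4) * r ^ 2 + (4 - 2) * r ^ α) := by
    have := sub_pos.2 hβα
    gcongr
  have h5 : 0 < α - 2 := by linarith
  refine lt_of_mul_lt_mul_left ?_ h5.le
  nlinarith

theorem measurable_potential {n : ℕ} (α : WithTop ℝ) (β : ℝ) :
    Measurable (potential (n := n) α β) := by
  cases α with
  | top =>
    refine Measurable.ite (measurableSet_le measurable_norm measurable_const) ?_ measurable_const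
    exact Measurable.coe_real_ereal (by fun_prop)
  | coe a => exact Measurable.coe_real_ereal (by fun_prop)

/-- The pair potential `W` dominates a positive multiple `c` of the quartic potential
`|x|⁴ - 2 |x|²`, with equality precisely at the separations `0` and `1`. -/
structure DominatesQuartic {n : ℕ} (W : EuclideanSpace ℝ (Fin n) → EReal) (c : ℝ) : Prop where
  pos : 0 < c
  lt_of_ne : ∀ x, ‖x‖ ≠ 0 → ‖x‖ ≠ 1 → ((c * (‖x‖ ^ 4 - 2 * ‖x‖ ^ 2) : ℝ) : EReal) < W x
  zero : ∀ x, ‖x‖ = 0 → W x = 0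
  one : ∀ x, ‖x‖ = 1 → W x = ((-c : ℝ) : EReal)

theorem DominatesQuartic.le {n : ℕ} {W : EuclideanSpace ℝ (Fin n) → EReal} {c : ℝ}
    (h : DominatesQuartic W c) (x : EuclideanSpace ℝ (Fin n)) :
    ((c * (‖x‖ ^ 4 - 2 * ‖x‖ ^ 2) : ℝ) : EReal) ≤ W x := by
  by_cases h0 : ‖x‖ = 0
  · rw [h.zero x h0, h0]; simp
  by_cases h1 : ‖x‖ = 1
  · rw [h.one x h1, h1, EReal.coe_le_coe_iff]; linarith
  exact (h.lt_of_ne x h0 h1).le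

theorem exists_dominatesQuartic_potential (n : ℕ) {α : WithTop ℝ} {β : ℝ} (hβ : 2 ≤ β)
    (hα : ((max 4 β : ℝ) : WithTop ℝ) < α) :
    ∃ c, DominatesQuartic (potential (n := n) α β) c := by
  have hβ0 : 0 < β := by linarith
  cases α with
  | top =>
    refine ⟨1 / β, by positivity, fun x h0 h1 => ?_, fun x h => ?_, fun x h => ?_⟩
    · simp only [potential]
      split_ifs with hx
      · rw [EReal.coe_lt_coe_iff]
        have hr : 0 < ‖x‖ := lt_of_le_of_ne (norm_nonneg x) (Ne.symm h0)
        have h2 : ‖x‖ ^ β ≤ ‖x‖ ^ 2 := by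
          have := Real.rpow_le_rpow_of_exponent_ge hr hx hβ
          rwa [Real.rpow_two] at this
        have h3 : ‖x‖ ^ 4 < ‖x‖ ^ 2 := by
          apply pow_lt_pow_right_of_lt_one₀ hr (lt_of_le_of_ne hx h1) (by norm_num)
        rw [div_mul_eq_mul_div, ← neg_div, div_lt_div_iff_of_pos_right hβ0]
        linarith
      · exact EReal.coe_lt_top _
    · simp [potential, h, Real.zero_rpow hβ0.ne']
    · simp [potential, h]
  | coe a =>
    have ha := max_lt_iff.1 (WithTop.coe_lt_coe.1 hα)
    have ha0 : 0 < a := by linarith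
    refine ⟨(a - β) / (a * β), div_pos (by linarith) (by positivity), fun x h0 h1 => ?_,
      fun x h => ?_, fun x h => ?_⟩
    · simp only [potential]
      rw [EReal.coe_lt_coe_iff]
      exact quartic_lt_powerLaw hβ ha.1 ha.2 (lt_of_le_of_ne (norm_nonneg x) (Ne.symm h0)) h1
    · simp [potential, h, Real.zero_rpow hβ0.ne', Real.zero_rpow ha0.ne']
    · simp only [potential, h, Real.one_rpow]
      congr 1
      field_simp
      ring

/-! ### Sharp lower bound for the quartic energy -/

variable {n : ℕ}

/-- The quartic energy of a centred probability measure with finite fourth moment. -/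
theorem quarticEnergy_ge_of_centred (μ : Measure (EuclideanSpace ℝ (Fin n)))
    [IsProbabilityMeasure μ] (h4 : Integrable (fun x => ‖x‖ ^ 4) μ)
    (h0 : ∀ i, ∫ x, x i ∂μ = 0) :
    -((n : ℝ) / (n + 1)) ≤
      ∫ p, (‖p.1 - p.2‖ ^ 4 - 2 * ‖p.1 - p.2‖ ^ 2) ∂(μ.prod μ) := by
  have dom : ∀ f : EuclideanSpace ℝ (Fin n) → ℝ, Measurable f →
      (∀ x, |f x| ≤ 1 + ‖x‖ ^ 4) → Integrable f μ := fun f hf hb =>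
    ((integrable_const (1 : ℝ)).add h4).mono' hf.aestronglyMeasurable (.of_forall hb)
  have hc : ∀ (x : EuclideanSpace ℝ (Fin n)) i, |x i| ≤ ‖x‖ := fun x i => by
    simpa using PiLp.norm_apply_le x i
  have i1 : ∀ i, Integrable (fun x : EuclideanSpace ℝ (Fin n) => x i) μ := fun i =>
    dom _ (by fun_prop) fun x => by
      nlinarith [hc x i, sq_nonneg (‖x‖ ^ 2 - 1), sq_nonneg (‖x‖ - 1), norm_nonneg x]
  have i2 : Integrable (fun x : EuclideanSpace ℝ (Fin n) => ‖x‖ ^ 2) μ :=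
    dom _ (by fun_prop) fun x => by
      rw [abs_of_nonneg (by positivity)]
      nlinarith [sq_nonneg (‖x‖ ^ 2 - 1)]
  have i3 : ∀ i, Integrable (fun x : EuclideanSpace ℝ (Fin n) => ‖x‖ ^ 2 * x i) μ := fun i =>
    dom _ (by fun_prop) fun x => by
      rw [abs_mul, abs_of_nonneg (by positivity : (0:ℝ) ≤ ‖x‖ ^ 2)]
      have : ‖x‖ ^ 2 * |x i| ≤ ‖x‖ ^ 2 * ‖x‖ := by gcongr; exact hc x i
      nlinarith [sq_nonneg (‖x‖ ^ 2 - ‖x‖), sq_nonneg (‖x‖ ^ 2 - 1)]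
  have i22 : ∀ i j, Integrable (fun x : EuclideanSpace ℝ (Fin n) => x i * x j) μ := fun i j =>
    dom _ (by fun_prop) fun x => by
      rw [abs_mul]
      have : |x i| * |x j| ≤ ‖x‖ * ‖x‖ := by gcongr <;> exact hc x _
      nlinarith [sq_nonneg (‖x‖ ^ 2 - 1)]
  set M2 := ∫ x, ‖x‖ ^ 2 ∂μ with hM2
  set M4 := ∫ x, ‖x‖ ^ 4 ∂μ with hM4
  set C : Fin n → Fin n → ℝ := fun i j => ∫ x, x i * x j ∂μ with hC
  have hone : Integrable (fun _ : EuclideanSpace ℝ (Fin n) => (1 : ℝ)) μ := integrable_const _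
  have key : ∫ p, (‖p.1 - p.2‖ ^ 4 - 2 * ‖p.1 - p.2‖ ^ 2) ∂(μ.prod μ)
      = 2 * M4 + 2 * M2 ^ 2 + 4 * ∑ i, ∑ j, C i j ^ 2 - 4 * M2 := by
    -- Every term is a product of a function of `x` and a function of `y`; the factors 1 keep this
    -- shape for `Integrable.mul_prod`. Each term of the last group has a bare coordinate as a
    -- factor, so centring kills it.
    have expand : ∀ p : EuclideanSpace ℝ (Fin n) × EuclideanSpace ℝ (Fin n),
        ‖p.1 - p.2‖ ^ 4 - 2 * ‖p.1 - p.2‖ ^ 2 =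
          (‖p.1‖ ^ 4 * 1 + 1 * ‖p.2‖ ^ 4 + 2 * (‖p.1‖ ^ 2 * ‖p.2‖ ^ 2)
            - 2 * (‖p.1‖ ^ 2 * 1) - 2 * (1 * ‖p.2‖ ^ 2))
          + 4 * ∑ i, ∑ j, (p.1 i * p.1 j) * (p.2 i * p.2 j)
          + (4 * ∑ i, p.1 i * p.2 i - 4 * ∑ i, (‖p.1‖ ^ 2 * p.1 i) * p.2 i
            - 4 * ∑ i, p.1 i * (‖p.2‖ ^ 2 * p.2 i)) := by
      rintro ⟨x, y⟩
      have e1 : ∑ i, x i * y i = inner ℝ x y := by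
        simp [PiLp.inner_apply, mul_comm]
      have e2 : ∑ i, ∑ j, (x i * x j) * (y i * y j) = (inner ℝ x y) ^ 2 := by
        rw [← e1, sq, Finset.sum_mul_sum]
        exact Finset.sum_congr rfl fun i _ => Finset.sum_congr rfl fun j _ => by ring
      have e3 : ∑ i, (‖x‖ ^ 2 * x i) * y i = ‖x‖ ^ 2 * inner ℝ x y := by
        rw [← e1, Finset.mul_sum]
        exact Finset.sum_congr rfl fun i _ => by ring
      have e4 : ∑ i, x i * (‖y‖ ^ 2 * y i) = ‖y‖ ^ 2 * inner ℝ x y := by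
        rw [← e1, Finset.mul_sum]
        exact Finset.sum_congr rfl fun i _ => by ring
      have e5 : ‖x - y‖ ^ 4 = (‖x - y‖ ^ 2) ^ 2 := by ring
      simp only [e1, e2, e3, e4, e5, norm_sub_sq_real]
      ring
    simp only [expand]
    have I1 := h4.mul_prod hone
    have I2 := hone.mul_prod h4
    have I3 := (i2.mul_prod i2).const_mul 2
    have I4 := (i2.mul_prod hone).const_mul 2
    have I5 := (hone.mul_prod i2).const_mul 2
    have I6 : ∀ i j, Integrable (fun p : EuclideanSpace ℝ (Fin n) × EuclideanSpace ℝ (Fin n) =>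
      (p.1 i * p.1 j) * (p.2 i * p.2 j)) (μ.prod μ) := fun i j => (i22 i j).mul_prod (i22 i j)
    have I7 : ∀ i, Integrable (fun p : EuclideanSpace ℝ (Fin n) × EuclideanSpace ℝ (Fin n) =>
      p.1 i * p.2 i) (μ.prod μ) := fun i => (i1 i).mul_prod (i1 i)
    have I8 : ∀ i, Integrable (fun p : EuclideanSpace ℝ (Fin n) × EuclideanSpace ℝ (Fin n) =>
      (‖p.1‖ ^ 2 * p.1 i) * p.2 i) (μ.prod μ) := fun i => (i3 i).mul_prod (i1 i)
    have I9 : ∀ i, Integrable (fun p : EuclideanSpace ℝ (Fin n) × EuclideanSpace ℝ (Fin n) =>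
      p.1 i * (‖p.2‖ ^ 2 * p.2 i)) (μ.prod μ) := fun i => (i1 i).mul_prod (i3 i)
    have J6 := (integrable_finsetSum Finset.univ fun i _ =>
      integrable_finsetSum Finset.univ fun j _ => I6 i j).const_mul 4
    have J7 := (integrable_finsetSum Finset.univ fun i _ => I7 i).const_mul 4
    have J8 := (integrable_finsetSum Finset.univ fun i _ => I8 i).const_mul 4
    have J9 := (integrable_finsetSum Finset.univ fun i _ => I9 i).const_mul 4
    have A2 : Integrable (fun p : EuclideanSpace ℝ (Fin n) × EuclideanSpace ℝ (Fin n) =>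
      ‖p.1‖ ^ 4 * 1 + 1 * ‖p.2‖ ^ 4) (μ.prod μ) := I1.add I2
    have A3 : Integrable (fun p : EuclideanSpace ℝ (Fin n) × EuclideanSpace ℝ (Fin n) =>
      ‖p.1‖ ^ 4 * 1 + 1 * ‖p.2‖ ^ 4 + 2 * (‖p.1‖ ^ 2 * ‖p.2‖ ^ 2)) (μ.prod μ) := A2.add I3
    have A4 : Integrable (fun p : EuclideanSpace ℝ (Fin n) × EuclideanSpace ℝ (Fin n) =>
      ‖p.1‖ ^ 4 * 1 + 1 * ‖p.2‖ ^ 4 + 2 * (‖p.1‖ ^ 2 * ‖p.2‖ ^ 2) - 2 * (‖p.1‖ ^ 2 * 1))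
      (μ.prod μ) := A3.sub I4
    have A5 : Integrable (fun p : EuclideanSpace ℝ (Fin n) × EuclideanSpace ℝ (Fin n) =>
      ‖p.1‖ ^ 4 * 1 + 1 * ‖p.2‖ ^ 4 + 2 * (‖p.1‖ ^ 2 * ‖p.2‖ ^ 2) - 2 * (‖p.1‖ ^ 2 * 1)
        - 2 * (1 * ‖p.2‖ ^ 2)) (μ.prod μ) := A4.sub I5
    have A6 : Integrable (fun p : EuclideanSpace ℝ (Fin n) × EuclideanSpace ℝ (Fin n) =>
      ‖p.1‖ ^ 4 * 1 + 1 * ‖p.2‖ ^ 4 + 2 * (‖p.1‖ ^ 2 * ‖p.2‖ ^ 2) - 2 * (‖p.1‖ ^ 2 * 1)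
        - 2 * (1 * ‖p.2‖ ^ 2) + 4 * ∑ i, ∑ j, (p.1 i * p.1 j) * (p.2 i * p.2 j))
      (μ.prod μ) := A5.add J6
    have B : Integrable (fun p : EuclideanSpace ℝ (Fin n) × EuclideanSpace ℝ (Fin n) =>
      4 * ∑ i, p.1 i * p.2 i - 4 * ∑ i, (‖p.1‖ ^ 2 * p.1 i) * p.2 i) (μ.prod μ) := J7.sub J8
    have BB : Integrable (fun p : EuclideanSpace ℝ (Fin n) × EuclideanSpace ℝ (Fin n) =>
      4 * ∑ i, p.1 i * p.2 i - 4 * ∑ i, (‖p.1‖ ^ 2 * p.1 i) * p.2 i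
        - 4 * ∑ i, p.1 i * (‖p.2‖ ^ 2 * p.2 i)) (μ.prod μ) := B.sub J9
    rw [integral_add A6 BB, integral_add A5 J6, integral_sub A4 I5,
      integral_sub A3 I4, integral_add A2 I3, integral_add I1 I2, integral_sub B J9,
      integral_sub J7 J8]
    simp only [integral_const_mul]
    rw [integral_finsetSum _ fun i _ => integrable_finsetSum Finset.univ fun j _ => I6 i j,
      integral_finsetSum _ fun i _ => I7 i, integral_finsetSum _ fun i _ => I8 i,
      integral_finsetSum _ fun i _ => I9 i]
    simp_rw [integral_finsetSum _ fun j _ => I6 _ j]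
    have P : ∀ f g : EuclideanSpace ℝ (Fin n) → ℝ,
      ∫ p, f p.1 * g p.2 ∂(μ.prod μ) = (∫ x, f x ∂μ) * ∫ y, g y ∂μ := fun f g =>
        integral_prod_mul f g
    have R1 : ∀ f : EuclideanSpace ℝ (Fin n) → ℝ, ∫ p, f p.1 ∂(μ.prod μ) = ∫ x, f x ∂μ :=
      fun f => by simpa using P f fun _ => 1
    have R2 : ∀ f : EuclideanSpace ℝ (Fin n) → ℝ, ∫ p, f p.2 ∂(μ.prod μ) = ∫ x, f x ∂μ :=
      fun f => by simpa using P (fun _ => 1) f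
    simp only [mul_one, one_mul]
    rw [R1 fun x => ‖x‖ ^ 4, R2 fun x => ‖x‖ ^ 4, R1 fun x => ‖x‖ ^ 2, R2 fun x => ‖x‖ ^ 2,
      P (fun x => ‖x‖ ^ 2) fun x => ‖x‖ ^ 2]
    have Q6 : ∀ i j, ∫ p, (p.1 i * p.1 j) * (p.2 i * p.2 j) ∂(μ.prod μ) = C i j ^ 2 := fun i j => by
      rw [sq]; exact P (fun x => x i * x j) fun x => x i * x j
    have Q7 : ∀ i, ∫ p, p.1 i * p.2 i ∂(μ.prod μ) = 0 := fun i => by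
      rw [P (fun x => x i) fun x => x i, h0, mul_zero]
    have Q8 : ∀ i, ∫ p, (‖p.1‖ ^ 2 * p.1 i) * p.2 i ∂(μ.prod μ) = 0 := fun i => by
      rw [P (fun x => ‖x‖ ^ 2 * x i) fun x => x i, h0, mul_zero]
    have Q9 : ∀ i, ∫ p, p.1 i * (‖p.2‖ ^ 2 * p.2 i) ∂(μ.prod μ) = 0 := fun i => by
      rw [P (fun x => x i) fun x => ‖x‖ ^ 2 * x i, h0, zero_mul]
    simp only [Q6, Q7, Q8, Q9, ← hM2, ← hM4]
    simp
    ring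
  rw [key]
  -- For the centred unit simplex the second-moment matrix is `s` times the identity and the squared
  -- circumradius is `n * s`. The squares below are expanded around these values, and the terms
  -- linear in `M2` then cancel.
  set s : ℝ := 1 / (2 * (n + 1)) with hs
  have hn : (0 : ℝ) < n + 1 := by positivity
  have hM : M4 ≥ 2 * (n * s) * M2 - (n * s) ^ 2 := by
    have : 0 ≤ ∫ x, (‖x‖ ^ 4 - 2 * (n * s) * ‖x‖ ^ 2 + (n * s) ^ 2) ∂μ :=
      integral_nonneg fun x => by
        have : ‖x‖ ^ 4 - 2 * (n * s) * ‖x‖ ^ 2 + (n * s) ^ 2 = (‖x‖ ^ 2 - n * s) ^ 2 := by ring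
        simp only [this, Pi.zero_apply]; positivity
    have hsub : Integrable (fun x => ‖x‖ ^ 4 - 2 * (n * s) * ‖x‖ ^ 2) μ :=
      h4.sub (i2.const_mul _)
    rw [integral_add hsub (integrable_const _),
      integral_sub h4 (i2.const_mul _), integral_const_mul] at this
    simp only [integral_const, probReal_univ, one_smul, ← hM2, ← hM4] at this
    linarith
  have htr : ∑ i, C i i = M2 := by
    rw [hM2, hC, ← integral_finsetSum _ fun i _ => i22 i i]
    refine integral_congr_ae (.of_forall fun x => ?_)
    simp only [EuclideanSpace.norm_sq_eq, Real.norm_eq_abs, sq_abs]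
    exact Finset.sum_congr rfl fun i _ => by ring
  have hCC : ∑ i, ∑ j, C i j ^ 2 ≥ 2 * s * M2 - n * s ^ 2 := by
    calc ∑ i, ∑ j, C i j ^ 2 ≥ ∑ i, C i i ^ 2 := Finset.sum_le_sum fun i _ =>
          Finset.single_le_sum (f := fun j => C i j ^ 2) (fun j _ => sq_nonneg _) (Finset.mem_univ i)
      _ ≥ ∑ i, (2 * s * C i i - s ^ 2) := Finset.sum_le_sum fun i _ => by
          nlinarith [sq_nonneg (C i i - s)]
      _ = _ := by rw [Finset.sum_sub_distrib, ← Finset.mul_sum, htr]; simp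
  have hsn : s * (n + 1) = 1 / 2 := by rw [hs]; field_simp
  have hd : (n : ℝ) / (n + 1) = 2 * (n * s) := by rw [hs]; field_simp
  have hlin : M2 * (s * (n + 1)) = M2 * (1 / 2) := by rw [hsn]
  have hq : n * s * (s * (n + 1)) = n * s * (1 / 2) := by rw [hsn]
  rw [hd]
  nlinarith [sq_nonneg (M2 - n * s)]

/-- Finite quartic energy makes `‖x - y‖ ^ 4` integrable in `x` for some fixed `y`, by Fubini. All
fourth moments are then finite, and translating the mean to the origin leaves the energy unchanged.
-/
theorem quarticEnergy_ge (μ : Measure (EuclideanSpace ℝ (Fin n))) [IsProbabilityMeasure μ]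
    (hq : Integrable (fun p : EuclideanSpace ℝ (Fin n) × EuclideanSpace ℝ (Fin n) =>
      ‖p.1 - p.2‖ ^ 4 - 2 * ‖p.1 - p.2‖ ^ 2) (μ.prod μ)) :
    -((n : ℝ) / (n + 1)) ≤
      ∫ p, (‖p.1 - p.2‖ ^ 4 - 2 * ‖p.1 - p.2‖ ^ 2) ∂(μ.prod μ) := by
  have h4 : Integrable (fun p : EuclideanSpace ℝ (Fin n) × EuclideanSpace ℝ (Fin n) =>
      ‖p.1 - p.2‖ ^ 4) (μ.prod μ) := by
    refine ((hq.const_mul 2).add (integrable_const (4 : ℝ))).mono'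
      (by fun_prop) (.of_forall fun p => ?_)
    rw [Real.norm_of_nonneg (by positivity)]
    simp only [Pi.add_apply]
    nlinarith [sq_nonneg (‖p.1 - p.2‖ ^ 2 - 2)]
  obtain ⟨y, hy⟩ := h4.prod_left_ae.exists
  have shift4 : ∀ m : EuclideanSpace ℝ (Fin n), Integrable (fun x => ‖x - m‖ ^ 4) μ := fun m => by
    refine ((hy.const_mul 8).add (integrable_const (8 * ‖y - m‖ ^ 4))).mono'
      (by fun_prop) (.of_forall fun x => ?_)
    rw [Real.norm_of_nonneg (by positivity)]
    simp only [Pi.add_apply]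
    have h : ‖x - m‖ ≤ ‖x - y‖ + ‖y - m‖ := norm_sub_le_norm_sub_add_norm_sub x y m
    have h' : ‖x - m‖ ^ 4 ≤ (‖x - y‖ + ‖y - m‖) ^ 4 := by gcongr
    have := add_pow_le (norm_nonneg (x - y)) (norm_nonneg (y - m)) 4
    norm_num at this
    linarith
  have i1 : ∀ i, Integrable (fun x : EuclideanSpace ℝ (Fin n) => x i) μ := fun i => by
    refine ((integrable_const (1 : ℝ)).add (shift4 0)).mono' (by fun_prop) (.of_forall fun x => ?_)
    have hc : ‖x i‖ ≤ ‖x‖ := PiLp.norm_apply_le x i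
    simp only [Pi.add_apply, sub_zero]
    nlinarith [sq_nonneg (‖x‖ ^ 2 - 1), sq_nonneg (‖x‖ - 1), norm_nonneg x]
  let m : EuclideanSpace ℝ (Fin n) := WithLp.toLp 2 fun i => ∫ x, x i ∂μ
  have hm : Measurable fun x : EuclideanSpace ℝ (Fin n) => x - m := by fun_prop
  let ν := μ.map fun x => x - m
  have : IsProbabilityMeasure ν := Measure.isProbabilityMeasure_map hm.aemeasurable
  have hν := quarticEnergy_ge_of_centred ν
    ((integrable_map_measure (by fun_prop) hm.aemeasurable).2 (shift4 m))
    (fun i => by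
      rw [integral_map hm.aemeasurable (by fun_prop)]
      simp only [PiLp.sub_apply]
      rw [integral_sub (i1 i) (integrable_const _)]
      simp [m])
  rw [show ν.prod ν = (μ.prod μ).map (Prod.map (fun x => x - m) fun x => x - m) from
    Measure.map_prod_map μ μ hm hm, integral_map (hm.prodMap hm).aemeasurable (by fun_prop)] at hν
  simpa using hν

/-! ### Energy bound for dominating potentials -/

/-- The energy of a measurable potential that is bounded below is either infinite or the integral
of the real-valued potential. -/
theorem energy_eq_top_or_integral {W : EuclideanSpace ℝ (Fin n) → EReal} (hW : Measurable W)
    {b : ℝ} (hb : ∀ x, (b : EReal) ≤ W x) (μ : ProbabilityMeasure (EuclideanSpace ℝ (Fin n))) :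
    energy W μ = ⊤ ∨
      (Integrable (fun p => (W (p.1 - p.2)).toReal) ((μ : Measure (EuclideanSpace ℝ (Fin n))).prod (μ : Measure (EuclideanSpace ℝ (Fin n)))) ∧
        (∀ᵐ p ∂((μ : Measure (EuclideanSpace ℝ (Fin n))).prod (μ : Measure (EuclideanSpace ℝ (Fin n)))),
          W (p.1 - p.2) = ((W (p.1 - p.2)).toReal : EReal)) ∧
        energy W μ =
          ((∫ p, (W (p.1 - p.2)).toReal ∂((μ : Measure (EuclideanSpace ℝ (Fin n))).prod (μ : Measure (EuclideanSpace ℝ (Fin n)))) : ℝ) : EReal)) := by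
  set π := (μ : Measure (EuclideanSpace ℝ (Fin n))).prod
    (μ : Measure (EuclideanSpace ℝ (Fin n))) with hπ
  have hWm : Measurable fun p : EuclideanSpace ℝ (Fin n) × EuclideanSpace ℝ (Fin n) =>
      W (p.1 - p.2) := hW.comp (measurable_fst.sub measurable_snd)
  -- The negative part is at most `-b` pointwise, so `∞ - ∞` cannot occur.
  have hN : ∫⁻ p, (-W (p.1 - p.2)).toENNReal ∂π ≠ ⊤ := by
    refine ne_top_of_le_ne_top ENNReal.ofReal_ne_top
      (b := ENNReal.ofReal (-b)) ?_
    calc ∫⁻ p, (-W (p.1 - p.2)).toENNReal ∂π ≤ ∫⁻ _, ENNReal.ofReal (-b) ∂π := by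
          refine lintegral_mono fun p => ?_
          rw [show ENNReal.ofReal (-b) = ((-b : ℝ) : EReal).toENNReal by simp]
          refine EReal.toENNReal_le_toENNReal ?_
          rw [EReal.coe_neg, EReal.neg_le_neg_iff]
          exact hb _
      _ = _ := by simp
  by_cases hP : ∫⁻ p, (W (p.1 - p.2)).toENNReal ∂π = ⊤
  · left
    rw [energy, ← hπ, hP, EReal.coe_ennreal_top]
    rw [← ENNReal.coe_toNNReal hN]
    exact EReal.top_sub_coe _
  right
  have hfin : ∀ᵐ p ∂π, W (p.1 - p.2) = ((W (p.1 - p.2)).toReal : EReal) := by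
    filter_upwards [ae_lt_top hWm.ereal_toENNReal hP] with p hp
    refine (EReal.coe_toReal (fun h => ?_) (fun h => ?_)).symm
    · simp [h] at hp
    · have := hb (p.1 - p.2)
      simp [h] at this
  have e1 : ∀ᵐ p ∂π, (W (p.1 - p.2)).toENNReal = ENNReal.ofReal (W (p.1 - p.2)).toReal := by
    filter_upwards [hfin] with p hp
    rw [EReal.toENNReal_of_ne_top (by rw [hp]; exact EReal.coe_ne_top _)]
  have e2 : ∀ᵐ p ∂π, (-W (p.1 - p.2)).toENNReal = ENNReal.ofReal (-(W (p.1 - p.2)).toReal) := by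
    filter_upwards [hfin] with p hp
    rw [EReal.toENNReal_of_ne_top (by rw [hp, ← EReal.coe_neg]; exact EReal.coe_ne_top _), hp,
      ← EReal.coe_neg, EReal.toReal_coe, EReal.toReal_coe]
  have hint : Integrable (fun p => (W (p.1 - p.2)).toReal) π := by
    refine ⟨hWm.ereal_toReal.aestronglyMeasurable, ?_⟩
    rw [hasFiniteIntegral_iff_norm]
    refine lt_of_le_of_lt (b := ∫⁻ p, (W (p.1 - p.2)).toENNReal + (-W (p.1 - p.2)).toENNReal ∂π)
      (lintegral_mono_ae ?_) ?_
    · filter_upwards [e1, e2] with p h1 h2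
      rw [h1, h2, Real.norm_eq_abs]
      rcases abs_cases (W (p.1 - p.2)).toReal with h | h <;> rw [h.1]
      exacts [le_self_add, le_add_self]
    · rw [lintegral_add_left hWm.ereal_toENNReal]
      exact ENNReal.add_lt_top.2 ⟨lt_top_iff_ne_top.2 hP, lt_top_iff_ne_top.2 hN⟩
  refine ⟨hint, hfin, ?_⟩
  rw [integral_eq_lintegral_pos_part_sub_lintegral_neg_part hint, energy, ← hπ,
    ← lintegral_congr_ae e1, ← lintegral_congr_ae e2, EReal.coe_sub,
    EReal.coe_ennreal_toReal hP, EReal.coe_ennreal_toReal hN]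

theorem neg_one_le_quartic (r : ℝ) : -1 ≤ r ^ 4 - 2 * r ^ 2 := by
  nlinarith [sq_nonneg (r ^ 2 - 1)]

theorem DominatesQuartic.neg_le {W : EuclideanSpace ℝ (Fin n) → EReal} {c : ℝ}
    (h : DominatesQuartic W c) (x : EuclideanSpace ℝ (Fin n)) : ((-c : ℝ) : EReal) ≤ W x :=
  le_trans (EReal.coe_le_coe_iff.2 (by nlinarith [neg_one_le_quartic ‖x‖, h.pos])) (h.le x)

/-- Integrating the pointwise domination reduces the bound to the quartic one. If the bound is
attained, both inequalities in the chain are equalities, and strict domination confines the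
separations to 0 and 1. -/
theorem DominatesQuartic.energy_ge {W : EuclideanSpace ℝ (Fin n) → EReal} {c : ℝ}
    (h : DominatesQuartic W c) (hW : Measurable W)
    (μ : ProbabilityMeasure (EuclideanSpace ℝ (Fin n))) :
    ((-(c * (n / (n + 1))) : ℝ) : EReal) ≤ energy W μ ∧
    (energy W μ ≤ ((-(c * (n / (n + 1))) : ℝ) : EReal) →
      (∀ᵐ p ∂((μ : Measure (EuclideanSpace ℝ (Fin n))).prod (μ : Measure (EuclideanSpace ℝ (Fin n)))), ‖p.1 - p.2‖ = 0 ∨ ‖p.1 - p.2‖ = 1) ∧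
      ∫ p, (‖p.1 - p.2‖ ^ 4 - 2 * ‖p.1 - p.2‖ ^ 2) ∂((μ : Measure (EuclideanSpace ℝ (Fin n))).prod (μ : Measure (EuclideanSpace ℝ (Fin n))))
        = -(n / (n + 1) : ℝ)) := by
  rcases energy_eq_top_or_integral hW h.neg_le μ with htop | ⟨hint, hfin, he⟩
  · rw [htop]
    exact ⟨le_top, fun h => absurd h (not_le.2 (EReal.coe_lt_top _))⟩
  set π := (μ : Measure (EuclideanSpace ℝ (Fin n))).prod
    (μ : Measure (EuclideanSpace ℝ (Fin n)))
  have hle : ∀ᵐ p ∂π, c * (‖p.1 - p.2‖ ^ 4 - 2 * ‖p.1 - p.2‖ ^ 2) ≤ (W (p.1 - p.2)).toReal := by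
    filter_upwards [hfin] with p hp
    have := h.le (p.1 - p.2)
    rwa [hp, EReal.coe_le_coe_iff] at this
  have hcq : Integrable (fun p : EuclideanSpace ℝ (Fin n) × EuclideanSpace ℝ (Fin n) =>
      c * (‖p.1 - p.2‖ ^ 4 - 2 * ‖p.1 - p.2‖ ^ 2)) π := by
    -- The scaled quartic lies between `-c` and the integrable `W`.
    refine (hint.norm.add (integrable_const c)).mono' (by fun_prop) ?_
    filter_upwards [hle] with p hp
    have h1 := neg_one_le_quartic ‖p.1 - p.2‖
    have h2 := h.pos
    simp only [Pi.add_apply, Real.norm_eq_abs]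
    rw [abs_le]
    have := le_abs_self (W (p.1 - p.2)).toReal
    have := abs_nonneg (W (p.1 - p.2)).toReal
    constructor <;> nlinarith
  have hq := (integrable_const_mul_iff h.pos.ne'.isUnit _).1 hcq
  have hge := quarticEnergy_ge (μ : Measure (EuclideanSpace ℝ (Fin n))) hq
  have hcge : -(c * (n / (n + 1))) ≤
      ∫ p, c * (‖p.1 - p.2‖ ^ 4 - 2 * ‖p.1 - p.2‖ ^ 2) ∂π := by
    rw [integral_const_mul, ← mul_neg]
    exact mul_le_mul_of_nonneg_left hge h.pos.le
  have hmono := integral_mono_ae hcq hint hle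
  rw [he, EReal.coe_le_coe_iff, EReal.coe_le_coe_iff]
  refine ⟨hcge.trans hmono, fun hE => ⟨?_, ?_⟩⟩
  · have heq := (integral_eq_iff_of_ae_le hcq hint hle).1 (by linarith)
    filter_upwards [heq, hfin] with p h1 h2
    by_contra! hne
    have := h.lt_of_ne _ hne.1 hne.2
    rw [h2, EReal.coe_lt_coe_iff] at this
    exact this.ne h1
  · refine le_antisymm ?_ hge
    have := hmono.trans hE
    rw [integral_const_mul, ← mul_neg] at this
    exact le_of_mul_le_mul_left this h.pos

/-! ### Unit simplices: dimension bound and existence -/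

theorem IsUnitSimplexVertices.dist_eq_one {k : ℕ} {x : Fin (k + 1) → EuclideanSpace ℝ (Fin n)}
    (h : IsUnitSimplexVertices x) {i j : Fin (k + 1)} (hij : i ≠ j) : dist (x i) (x j) = 1 := by
  rcases lt_or_gt_of_ne hij with hlt | hlt
  · exact h i j hlt
  · rw [dist_comm]; exact h j i hlt

theorem IsUnitSimplexVertices.injective {k : ℕ} {x : Fin (k + 1) → EuclideanSpace ℝ (Fin n)}
    (h : IsUnitSimplexVertices x) : Function.Injective x := fun i j hij => by
  by_contra hne
  have := h.dist_eq_one hne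
  simp [hij] at this

/-- The edge vectors from one vertex have Gram matrix `(I + J) / 2`, with `J` the all-ones matrix.
It is nonsingular, so these `k` vectors are independent. -/
theorem IsUnitSimplexVertices.le_dim {k : ℕ} {x : Fin (k + 1) → EuclideanSpace ℝ (Fin n)}
    (h : IsUnitSimplexVertices x) : k ≤ n := by
  let v : Fin k → EuclideanSpace ℝ (Fin n) := fun i => x i.succ - x 0
  have hv1 : ∀ i, ‖v i‖ = 1 := fun i => by
    rw [← dist_eq_norm]; exact h.dist_eq_one (Fin.succ_ne_zero i)
  have hv : ∀ i j, inner ℝ (v i) (v j) = 1 / 2 + if i = j then (1 / 2 : ℝ) else 0 := fun i j => by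
    split_ifs with hij
    · rw [hij, real_inner_self_eq_norm_sq, hv1]; norm_num
    · have h1 : ‖v i - v j‖ = 1 := by
        have : v i - v j = x i.succ - x j.succ := by simp [v]
        rw [this, ← dist_eq_norm]
        exact h.dist_eq_one fun e => hij (Fin.succ_injective _ e)
      have h2 := norm_sub_sq_real (v i) (v j)
      rw [h1, hv1, hv1] at h2
      linarith
  have hli : LinearIndependent ℝ v := by
    rw [Fintype.linearIndependent_iff]
    intro g hg
    have h1 : ∀ j, g j = -∑ i, g i := fun j => by
      have h2 : inner ℝ (∑ i, g i • v i) (v j) = 0 := by rw [hg, inner_zero_left]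
      simp only [sum_inner, real_inner_smul_left, hv, mul_add, Finset.sum_add_distrib, mul_ite,
        mul_zero, Finset.sum_ite_eq', Finset.mem_univ, if_true, ← Finset.sum_mul] at h2
      linarith
    have h2 : ∑ i, g i = 0 := by
      have h3 : ∑ i, g i = k * -∑ i, g i := by
        conv_lhs => rw [Finset.sum_congr rfl fun j _ => h1 j]
        simp
      have h4 : ((k : ℝ) + 1) * ∑ i, g i = 0 := by linarith
      exact (mul_eq_zero.1 h4).resolve_left (by positivity)
    intro i
    rw [h1, h2, neg_zero]
  simpa using hli.fintype_card_le_finrank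

/-- The standard basis vectors of `ℝⁿ⁺¹`, scaled by `1 / √2`, have mutual distance one. Their
differences are orthogonal to `(1, …, 1)`, so projecting to that hyperplane preserves distances. -/
theorem exists_isUnitSimplexVertices (n : ℕ) :
    ∃ x : Fin (n + 1) → EuclideanSpace ℝ (Fin n), IsUnitSimplexVertices x := by
  let v : EuclideanSpace ℝ (Fin (n + 1)) := WithLp.toLp 2 fun _ => 1
  have hv : v ≠ 0 := fun h => by
    have := congrArg (fun w : EuclideanSpace ℝ (Fin (n + 1)) => w 0) h
    simp [v] at this
  have : Fact (Module.finrank ℝ (EuclideanSpace ℝ (Fin (n + 1))) = n + 1) := ⟨by simp⟩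
  let b := OrthonormalBasis.fromOrthogonalSpanSingleton (𝕜 := ℝ) n hv
  let e : Fin (n + 1) → EuclideanSpace ℝ (Fin (n + 1)) := fun i => EuclideanSpace.single i 1
  refine ⟨fun i => b.repr ((1 / √2 : ℝ) • (ℝ ∙ v)ᗮ.orthogonalProjectionOnto (e i)),
    fun i j hij => ?_⟩
  have hmem : e i - e j ∈ (ℝ ∙ v)ᗮ := by
    rw [Submodule.mem_orthogonal_singleton_iff_inner_right]
    simp [inner_sub_right, e, v, EuclideanSpace.inner_single_right]
  rw [LinearIsometryEquiv.dist_map, dist_eq_norm, ← smul_sub, ← map_sub, norm_smul,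
    Submodule.coe_norm, Submodule.starProjection_apply .. |>.symm,
    Submodule.starProjection_eq_self_iff.2 hmem, ← dist_eq_norm]
  have hd : dist (e i) (e j) = √2 := by
    rw [dist_eq_norm, ← Real.sqrt_sq (norm_nonneg (e i - e j)), norm_sub_sq_real]
    simp only [e, EuclideanSpace.inner_single_left, PiLp.norm_single]
    simp [hij.ne]
    norm_num
  rw [hd, Real.norm_of_nonneg (by positivity), one_div_mul_cancel (by positivity)]

theorem exists_equidistributesOverUnitSimplex (n : ℕ) :
    ∃ μ : ProbabilityMeasure (EuclideanSpace ℝ (Fin n)), EquidistributesOverUnitSimplex μ := by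
  obtain ⟨x, hx⟩ := exists_isUnitSimplexVertices n
  let μ : Measure (EuclideanSpace ℝ (Fin n)) := ∑ i, ((n : ℝ≥0∞) + 1)⁻¹ • Measure.dirac (x i)
  have hμ : IsProbabilityMeasure μ := ⟨by
    simp only [μ, Measure.finsetSum_apply, Measure.smul_apply, measure_univ, smul_eq_mul, mul_one,
      Finset.sum_const, Finset.card_univ, Fintype.card_fin, nsmul_eq_mul, Nat.cast_add,
      Nat.cast_one]
    exact ENNReal.mul_inv_cancel (by simp) (by simp)⟩
  refine ⟨⟨μ, hμ⟩, x, hx, fun i => ?_⟩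
  have : ∀ j, (Measure.dirac (x j) : Measure (EuclideanSpace ℝ (Fin n))) {x i}
      = if i = j then 1 else 0 := fun j => by
    rw [Measure.dirac_apply]
    by_cases hij : i = j
    · simp [hij]
    · simp [hij, hx.injective.eq_iff, Ne.symm hij]
  simp [μ, Measure.finsetSum_apply, this]

/-! ### The equality case -/

/-- The condition is closed: a failure at `(x, y)` would persist on a product of neighbourhoods,
which has positive measure. -/
theorem dist_mem_of_mem_support {μ : Measure (EuclideanSpace ℝ (Fin n))} [SFinite μ]
    (h : ∀ᵐ p ∂(μ.prod μ), ‖p.1 - p.2‖ = 0 ∨ ‖p.1 - p.2‖ = 1)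
    {x y : EuclideanSpace ℝ (Fin n)} (hx : x ∈ μ.support) (hy : y ∈ μ.support) :
    ‖x - y‖ = 0 ∨ ‖x - y‖ = 1 := by
  let K : Set (EuclideanSpace ℝ (Fin n) × EuclideanSpace ℝ (Fin n)) :=
    {p | ‖p.1 - p.2‖ = 0 ∨ ‖p.1 - p.2‖ = 1}
  have hK : IsClosed K :=
    (isClosed_eq (by fun_prop) (by fun_prop)).union (isClosed_eq (by fun_prop) (by fun_prop))
  by_contra hne
  obtain ⟨U, hU, V, hV, hUV⟩ := mem_nhds_prod_iff.1 (hK.isOpen_compl.mem_nhds (x := (x, y)) hne)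
  have h0 : μ.prod μ (U ×ˢ V) = 0 := measure_mono_null hUV h
  rw [Measure.prod_prod, mul_eq_zero] at h0
  rw [Measure.mem_support_iff_forall] at hx hy
  exact h0.elim (hx U hU).ne' (hy V hV).ne'

theorem encard_le_of_pairwise_dist_eq_one {S : Set (EuclideanSpace ℝ (Fin n))}
    (hS : S.Pairwise fun x y => dist x y = 1) : S.encard ≤ n + 1 := by
  by_contra! hlt
  obtain ⟨T, hTS, hT⟩ := Set.exists_subset_encard_eq (Order.add_one_le_of_lt hlt)
  have hTf : T.Finite := Set.finite_of_encard_eq_coe (k := n + 2) (by rw [hT]; push_cast; ring)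
  have hcard : hTf.toFinset.card = n + 1 + 1 := by
    have h2 := hTf.encard_eq_coe_toFinset_card
    rw [hT] at h2
    exact_mod_cast h2.symm
  let e := hTf.toFinset.equivFinOfCardEq hcard
  have hx : IsUnitSimplexVertices fun i => (e.symm i : EuclideanSpace ℝ (Fin n)) := fun i j hij =>
    hS (hTS (hTf.mem_toFinset.1 (e.symm i).2)) (hTS (hTf.mem_toFinset.1 (e.symm j).2))
      fun h => hij.ne (e.symm.injective (Subtype.ext h))
  have := hx.le_dim
  omega

theorem equidistributesOverUnitSimplex_of_quarticEnergy
    {μ : ProbabilityMeasure (EuclideanSpace ℝ (Fin n))}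
    (h : ∀ᵐ p ∂((μ : Measure (EuclideanSpace ℝ (Fin n))).prod (μ : Measure (EuclideanSpace ℝ (Fin n)))), ‖p.1 - p.2‖ = 0 ∨ ‖p.1 - p.2‖ = 1)
    (hE : ∫ p, (‖p.1 - p.2‖ ^ 4 - 2 * ‖p.1 - p.2‖ ^ 2) ∂((μ : Measure (EuclideanSpace ℝ (Fin n))).prod (μ : Measure (EuclideanSpace ℝ (Fin n))))
        = -(n / (n + 1) : ℝ)) :
    EquidistributesOverUnitSimplex μ := by
  set ν : Measure (EuclideanSpace ℝ (Fin n)) := (μ : Measure (EuclideanSpace ℝ (Fin n))) with hν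
  have hS : ν.support.Pairwise fun x y => dist x y = 1 := fun x hx y hy hxy => by
    change dist x y = 1
    rw [dist_eq_norm]
    exact (dist_mem_of_mem_support h hx hy).resolve_left fun h0 =>
      hxy (sub_eq_zero.1 (norm_eq_zero.1 h0))
  have hcard := encard_le_of_pairwise_dist_eq_one hS
  have hfin : ν.support.Finite := Set.finite_of_encard_le_coe (k := n + 1) (by exact_mod_cast hcard)
  set T := hfin.toFinset with hT
  have hTn : T.card ≤ n + 1 := by
    rw [hfin.encard_eq_coe_toFinset_card] at hcard
    exact_mod_cast hcard
  have hsum : ∑ x ∈ T, ν.real {x} = 1 := by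
    rw [sum_measureReal_singleton, hT, hfin.coe_toFinset, measureReal_def,
      (prob_compl_eq_zero_iff₀ Measure.nullMeasurableSet_support).1 Measure.measure_compl_support,
      ENNReal.toReal_one]
  let D : Set (EuclideanSpace ℝ (Fin n) × EuclideanSpace ℝ (Fin n)) := Set.diagonal _
  have hD : MeasurableSet D := isClosed_diagonal.measurableSet
  -- On separations 0 and 1 the quartic equals the indicator of the diagonal minus one.
  have hdiag : (ν.prod ν).real D = 1 / (n + 1) := by
    have e : ∫ p, (‖p.1 - p.2‖ ^ 4 - 2 * ‖p.1 - p.2‖ ^ 2) ∂(ν.prod ν)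
        = ∫ p, (D.indicator (fun _ => (1 : ℝ)) p - 1) ∂(ν.prod ν) := by
      refine integral_congr_ae ?_
      filter_upwards [h] with p hp
      rcases hp with hp | hp
      · have : p ∈ D := sub_eq_zero.1 (norm_eq_zero.1 hp)
        simp [hp, this]
      · have : p ∉ D := fun hpD => by
          rw [show p.1 = p.2 from hpD] at hp
          simp at hp
        norm_num [hp, this]
    rw [hE, integral_sub ((integrable_const _).indicator hD) (integrable_const _),
      integral_indicator_const _ hD] at e
    simp only [smul_eq_mul, mul_one, integral_const, probReal_univ] at e
    have : (ν.prod ν).real D = 1 - n / (n + 1) := by linarith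
    rw [this]
    field_simp
    ring
  have hsq : ∑ x ∈ T, ν.real {x} ^ 2 ≤ 1 / (n + 1) := by
    rw [← hdiag]
    calc ∑ x ∈ T, ν.real {x} ^ 2 = ∑ x ∈ T, (ν.prod ν).real {(x, x)} := by
          refine Finset.sum_congr rfl fun x _ => ?_
          rw [← Set.singleton_prod_singleton, measureReal_prod_prod, sq]
      _ = ∑ p ∈ T.map ⟨fun x => (x, x), fun x y hxy => (Prod.mk.inj hxy).1⟩,
            (ν.prod ν).real {p} := by rw [Finset.sum_map]; rfl
      _ ≤ (ν.prod ν).real D := by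
          rw [sum_measureReal_singleton]
          refine measureReal_mono fun p hp => ?_
          simp only [Finset.coe_map, Set.mem_image] at hp
          obtain ⟨x, -, rfl⟩ := hp
          rfl
  have hn : (0 : ℝ) < n + 1 := by positivity
  -- This is the equality case of Cauchy–Schwarz; the bound `T.card ≤ n + 1` enters through the
  -- constant term.
  have hdev : ∑ x ∈ T, (ν.real {x} - 1 / (n + 1)) ^ 2 ≤ 0 := by
    have hTn' : (T.card : ℝ) ≤ n + 1 := by exact_mod_cast hTn
    calc ∑ x ∈ T, (ν.real {x} - 1 / (n + 1)) ^ 2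
        = ∑ x ∈ T, ν.real {x} ^ 2 - 2 / (n + 1) * ∑ x ∈ T, ν.real {x}
            + T.card * (1 / (n + 1)) ^ 2 := by
          rw [Finset.mul_sum, ← Finset.sum_sub_distrib, ← nsmul_eq_mul, ← Finset.sum_const,
            ← Finset.sum_add_distrib]
          exact Finset.sum_congr rfl fun x _ => by ring
      _ ≤ 1 / (n + 1) - 2 / (n + 1) * 1 + (n + 1) * (1 / (n + 1)) ^ 2 := by rw [hsum]; gcongr
      _ = 0 := by field_simp; ring
  have hmass : ∀ x ∈ T, ν.real {x} = 1 / (n + 1) := fun x hx => by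
    have h0 := (Finset.sum_eq_zero_iff_of_nonneg fun x _ => sq_nonneg _).1
      (le_antisymm hdev (Finset.sum_nonneg fun x _ => sq_nonneg _)) x hx
    linarith [pow_eq_zero_iff (two_ne_zero) |>.1 h0]
  have hTcard : T.card = n + 1 := by
    rw [Finset.sum_congr rfl hmass, Finset.sum_const, nsmul_eq_mul] at hsum
    field_simp at hsum
    exact_mod_cast hsum
  let e := T.equivFinOfCardEq hTcard
  have hmem : ∀ i, (e.symm i : EuclideanSpace ℝ (Fin n)) ∈ ν.support := fun i =>
    hfin.mem_toFinset.1 (e.symm i).2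
  refine ⟨fun i => e.symm i, fun i j hij => hS (hmem i) (hmem j) fun h =>
    hij.ne (e.symm.injective (Subtype.ext h)), fun i => ?_⟩
  rw [← ENNReal.ofReal_toReal (measure_ne_top ν _)]
  rw [← measureReal_def, hmass _ (e.symm i).2, one_div, ENNReal.ofReal_inv_of_pos hn,
    ENNReal.ofReal_add (by positivity) zero_le_one]
  simp

/-! ### Energy of an equidistributed simplex -/

/-- The `n + 1` distinct points already carry total mass one, so nothing lies elsewhere and the
product measure is purely atomic. -/
theorem lintegral_prod_eq_sum {x : Fin (n + 1) → EuclideanSpace ℝ (Fin n)}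
    (hx : Function.Injective x) (μ : Measure (EuclideanSpace ℝ (Fin n))) [IsProbabilityMeasure μ]
    (hμ : ∀ i, μ {x i} = ((n : ℝ≥0∞) + 1)⁻¹)
    (f : EuclideanSpace ℝ (Fin n) × EuclideanSpace ℝ (Fin n) → ℝ≥0∞) :
    ∫⁻ p, f p ∂(μ.prod μ) =
      ∑ i, ∑ j, f (x i, x j) * (((n : ℝ≥0∞) + 1)⁻¹ * ((n : ℝ≥0∞) + 1)⁻¹) := by
  let T : Finset (EuclideanSpace ℝ (Fin n)) := Finset.univ.map ⟨x, hx⟩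
  have hT : μ T = 1 := by
    rw [← sum_measure_singleton]
    simp only [T, Finset.sum_map, Function.Embedding.coeFn_mk, hμ, Finset.sum_const,
      Finset.card_univ, Fintype.card_fin, nsmul_eq_mul, Nat.cast_add, Nat.cast_one]
    exact ENNReal.mul_inv_cancel (by simp) (by simp)
  have hTT : μ.prod μ ((T ×ˢ T : Finset _) : Set _) = 1 := by
    rw [Finset.coe_product, Measure.prod_prod, hT, one_mul]
  have hae : ∀ᵐ p ∂(μ.prod μ), p ∈ ((T ×ˢ T : Finset _) : Set _) := by
    rw [← prob_compl_eq_zero_iff (Finset.measurableSet _)] at hTT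
    exact hTT
  rw [← Measure.restrict_eq_self_of_ae_mem hae, lintegral_finset, Finset.sum_product]
  simp only [T, Finset.sum_map, Function.Embedding.coeFn_mk]
  refine Finset.sum_congr rfl fun i _ => Finset.sum_congr rfl fun j _ => ?_
  rw [← Set.singleton_prod_singleton, Measure.prod_prod, hμ, hμ]

/-- Each of the `n * (n + 1)` ordered pairs of distinct vertices contributes `-c`, with weight `1 /
(n + 1) ^ 2`. -/
theorem DominatesQuartic.energy_eq {W : EuclideanSpace ℝ (Fin n) → EReal} {c : ℝ}
    (h : DominatesQuartic W c) {μ : ProbabilityMeasure (EuclideanSpace ℝ (Fin n))}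
    (hμ : EquidistributesOverUnitSimplex μ) :
    energy W μ = ((-(c * (n / (n + 1))) : ℝ) : EReal) := by
  obtain ⟨x, hx, hm⟩ := hμ
  have hW : ∀ i j, W (x i - x j) = ((if i = j then 0 else -c : ℝ) : EReal) := fun i j => by
    split_ifs with hij
    · rw [h.zero _ (by simp [hij])]; rfl
    · rw [h.one _ (by rw [← dist_eq_norm]; exact hx.dist_eq_one hij)]
  have hn : (0 : ℝ) < n + 1 := by positivity
  have hw : ((n : ℝ≥0∞) + 1)⁻¹ = ENNReal.ofReal (1 / (n + 1)) := by
    rw [one_div, ENNReal.ofReal_inv_of_pos hn, ENNReal.ofReal_add (by positivity) zero_le_one]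
    simp
  have hpos : ∀ i j, (W (x i - x j)).toENNReal = 0 := fun i j => by
    rw [hW, EReal.real_coe_toENNReal, ENNReal.ofReal_eq_zero]
    split_ifs
    exacts [le_rfl, neg_nonpos.2 h.pos.le]
  have hneg : ∀ i j, (-W (x i - x j)).toENNReal = ENNReal.ofReal (if i = j then 0 else c) :=
    fun i j => by
      rw [hW, ← EReal.coe_neg, EReal.real_coe_toENNReal]
      split_ifs <;> simp
  have hc : ∀ i j : Fin (n + 1), 0 ≤ if i = j then 0 else c := fun i j => by
    split_ifs
    exacts [le_rfl, h.pos.le]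
  rw [energy, lintegral_prod_eq_sum hx.injective _ hm, lintegral_prod_eq_sum hx.injective _ hm]
  simp only [hpos, hneg, hw, zero_mul, Finset.sum_const_zero]
  simp_rw [← ENNReal.ofReal_mul (show (0 : ℝ) ≤ 1 / (n + 1) by positivity),
    ← ENNReal.ofReal_mul (hc _ _)]
  have hc' : ∀ i j : Fin (n + 1),
      0 ≤ (if i = j then 0 else c) * (1 / (n + 1) * (1 / (n + 1)) : ℝ) := fun i j =>
    mul_nonneg (hc i j) (by positivity)
  simp_rw [← ENNReal.ofReal_sum_of_nonneg fun j _ => hc' _ j]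
  rw [← ENNReal.ofReal_sum_of_nonneg fun i _ => Finset.sum_nonneg fun j _ => hc' i j,
    EReal.coe_ennreal_ofReal, max_eq_left
      (Finset.sum_nonneg fun i _ => Finset.sum_nonneg fun j _ => hc' i j),
    EReal.coe_ennreal_zero, zero_sub, ← EReal.coe_neg]
  congr 2
  have hsum : ∀ i : Fin (n + 1), ∑ j, (if i = j then 0 else c) = n * c := fun i => by
    have : ∀ j, (if i = j then 0 else c) = c - if i = j then c else 0 := fun j => by
      split_ifs <;> simp
    simp only [this, Finset.sum_sub_distrib, Finset.sum_ite_eq, Finset.mem_univ, if_true]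
    simp
    ring
  simp_rw [← Finset.sum_mul, hsum]
  rw [Finset.sum_const]
  simp
  field_simp

/-- For `β ≥ 2` and `α > max 4 β` the minimizers are exactly the equidistributed unit simplices. -/
theorem isEnergyMinimizer_iff {α : WithTop ℝ} {β : ℝ} (hβ : 2 ≤ β)
    (hα : ((max 4 β : ℝ) : WithTop ℝ) < α)
    (μ : ProbabilityMeasure (EuclideanSpace ℝ (Fin n))) :
    IsEnergyMinimizer α β μ ↔ EquidistributesOverUnitSimplex μ := by
  obtain ⟨c, hc⟩ := exists_dominatesQuartic_potential n hβ hα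
  have hW := measurable_potential (n := n) α β
  constructor
  · intro hmin
    obtain ⟨ν, hν⟩ := exists_equidistributesOverUnitSimplex n
    obtain ⟨h1, h2⟩ := (hc.energy_ge hW μ).2 ((hmin ν).trans_eq (hc.energy_eq hν))
    exact equidistributesOverUnitSimplex_of_quarticEnergy h1 h2
  · intro hμ ν
    rw [hc.energy_eq hμ]
    exact (hc.energy_ge hW ν).1

end PowerLaw

/-! ### The threshold -/

theorem corollaryC (n : ℕ) (β : ℝ) (hβ : 2 ≤ β) :
    ∃ αΔ : ℝ, IsLeast
      {a : ℝ | β ≤ a ∧ ∀ α : WithTop ℝ, (a : WithTop ℝ) < α →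
        ∀ μ : ProbabilityMeasure (EuclideanSpace ℝ (Fin n)),
          PowerLaw.IsEnergyMinimizer α β μ ↔ PowerLaw.EquidistributesOverUnitSimplex μ} αΔ := by
  set S := {a : ℝ | β ≤ a ∧ ∀ α : WithTop ℝ, (a : WithTop ℝ) < α →
        ∀ μ : ProbabilityMeasure (EuclideanSpace ℝ (Fin n)),
          PowerLaw.IsEnergyMinimizer α β μ ↔ PowerLaw.EquidistributesOverUnitSimplex μ} with hS
  have hne : S.Nonempty :=
    ⟨max 4 β, le_max_right _ _, fun α hα μ => PowerLaw.isEnergyMinimizer_iff hβ hα μ⟩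
  have hbdd : BddBelow S := ⟨β, fun a ha => ha.1⟩
  -- The infimum is itself admissible: every `α` strictly above it exceeds some admissible `a`.
  refine ⟨sInf S, ⟨le_csInf hne fun a ha => ha.1, fun α hα => ?_⟩, fun a ha => csInf_le hbdd ha⟩
  cases α with
  | top =>
    obtain ⟨a, ha⟩ := hne
    exact ha.2 ⊤ (WithTop.coe_lt_top a)
  | coe α =>
    obtain ⟨a, ha, haα⟩ := exists_lt_of_csInf_lt hne (WithTop.coe_lt_coe.1 hα)
    exact ha.2 α (WithTop.coe_lt_coe.2 haα)
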